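/- An effect algebra is a set $E$ with two distinct elements $0,1$ and a partial binary operation $\oplus$ such that: $a\oplus b=b\oplus a$ whenever one side is defined; $(a\oplus b)\oplus c=a\oplus(b\oplus c)$ whenever one side is defined; for each $a$ there is a unique $a'$ with $a\oplus a'=1$; and $a=0$ whenever $1\oplus a$ is defined. It is ordered by $a\le b$ iff $a\oplus c=b$ for some (unique) $c$, written $c=b\ominus a$; it is a (complete) lattice effect algebra if this order is a (complete) lattice order. In a lattice effect algebra, $x,y$ are compatible if $x\vee y=x\oplus(y\ominus(x\wedge y))$; a block is a maximal set of pairwise compatible elements, and $E$ is block-finite if it has only finitely many blocks. An atom is a minimal nonzero element; $E$ is atomic if every nonzero element is above an atom. For a positive integer $l$, $la$ denotes the $l$-fold sum $a\oplus\dots\oplus a$, if it exists. A net $(x_\alpha)$ in $E$ order converges to $x$ if there are nets $(u_\alpha),(v_\alpha)$ over the same directed set with $u_\alpha\le x_\alpha\le v_\alpha$ for all $\alpha$, $(u_\alpha)$ increasing with $\bigvee u_\alpha=x$, and $(v_\alpha)$ decreasing with $\bigwedge v_\alpha=x$. The order topology $\tau_o$ is the finest topology in which every order convergent net converges to its order limits.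 The interval topology $\tau_i$ has the intervals $[a,b]$, $a\le b$, as a closed subbasis. Let $\mathcal U$ be the set of all finite joins of elements $la$ with $a$ an atom, $l\ge 1$ and $la$ defined. Then $\tau_\Phi$ is the topology of the uniformity on $E$ induced by the pseudometrics $|\varphi(x)-\varphi(y)|$, where $\varphi$ runs through the indicator functions of the sets $\{x: u\le x\}$ with $u\in\mathcal U$ and of the sets $\{x: x\le v\}$ with $v'\in\mathcal U$. **Theorem.** Let $E$ be a block-finite complete atomic lattice effect algebra. The following conditions are equivalent: 1. $E$ is almost orthogonal, i.e. for every atom $a$ the set of atoms $b$ with $b\not\le a'$ is finite; 2. $E$ is compactly generated, i.e. every element is a join of compact elements, where $c$ is compact if $c\le\bigvee D$ implies $c\le\bigvee F$ for some finite $F\subseteq D$; 3. $E$ is (o)-continuous, i.e. for every increasing net $(x_\alpha)$ with $\bigvee x_\alpha=x$ and every $y\in E$ one has $\bigvee(x_\alpha\wedge y)=x\wedge y$; 4. $\tau_i=\tau_o=\tau_\Phi$, and a net in $E$ converges to a point in $\tau_o$ if and only if it order converges to that point. -/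

import Mathlib

open Filter Set

universe u

/-- An effect algebra `(E; ⊕, 0, 1)`: the partial operation `⊕` is a map into `Option E`
(`none` = undefined). -/
class EffectAlgebra (E : Type u) extends Zero E, One E where
  oplus : E → E → Option E
  zero_ne_one' : (0 : E) ≠ 1
  oplus_comm : ∀ a b : E, oplus a b = oplus b a
  oplus_assoc : ∀ a b c : E,
    (oplus a b).bind (fun s => oplus s c) = (oplus b c).bind (fun t => oplus a t)
  existsUnique_orthosupplement : ∀ a : E, ∃! b : E, oplus a b = some 1
  eq_zero_of_one_oplus : ∀ a : E, (oplus 1 a).isSome → a = 0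

/-- A lattice effect algebra: an effect algebra whose natural order
(`a ≤ b` iff `a ⊕ c = b` for some `c`) is a lattice order. -/
class LatticeEffectAlgebra (E : Type u) extends EffectAlgebra E, Lattice E where
  le_iff_exists_oplus : ∀ a b : E, a ≤ b ↔ ∃ c : E, oplus a c = some b

namespace EffectAlgebra

/-- The orthosupplement `a'`: the unique element with `a ⊕ a' = 1`. -/
noncomputable def orthosupplement {E : Type u} [EffectAlgebra E] (a : E) : E :=
  (existsUnique_orthosupplement a).choose

theorem oplus_orthosupplement {E : Type u} [EffectAlgebra E] (a : E) :
    oplus a (orthosupplement a) = some 1 :=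
  (existsUnique_orthosupplement a).choose_spec.1

theorem oplus_zero {E : Type u} [EffectAlgebra E] (a : E) : oplus a 0 = some a := by
  have h1 : oplus (1 : E) 0 = some 1 := by
    have h := oplus_orthosupplement (1 : E)
    have h0 : orthosupplement (1 : E) = 0 := eq_zero_of_one_oplus _ (by rw [h]; rfl)
    rwa [h0] at h
  have ha := oplus_orthosupplement a
  rw [oplus_comm] at ha
  have hassoc := oplus_assoc (orthosupplement a) a 0
  rw [ha, Option.bind_some, h1] at hassoc
  obtain ⟨t, ht, ht'⟩ := Option.bind_eq_some_iff.1 hassoc.symm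
  rw [ht]
  exact congrArg some ((existsUnique_orthosupplement (orthosupplement a)).unique ht' ha)

/-- The `n`-fold sum `n a = a ⊕ ⋯ ⊕ a`, if it exists. -/
def multiple {E : Type u} [EffectAlgebra E] : ℕ → E → Option E
  | 0, _ => some 0
  | n + 1, a => (multiple n a).bind (fun s => oplus s a)

end EffectAlgebra

namespace LatticeEffectAlgebra

open EffectAlgebra

/-- `0` and `1` are the least and the greatest element of a lattice effect algebra. -/
instance instBoundedOrder (E : Type u) [LatticeEffectAlgebra E] : BoundedOrder E where
  bot := 0
  bot_le a := (le_iff_exists_oplus 0 a).2 ⟨a, by rw [oplus_comm]; exact oplus_zero a⟩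
  top := 1
  le_top a := (le_iff_exists_oplus a 1).2 ⟨orthosupplement a, oplus_orthosupplement a⟩

/-- `x ↔ y`: `x ∨ y = x ⊕ (y ⊖ (x ∧ y))`, where `d = y ⊖ (x ∧ y)` means `(x ∧ y) ⊕ d = y`. -/
def Compatible {E : Type u} [LatticeEffectAlgebra E] (x y : E) : Prop :=
  ∃ d : E, oplus (x ⊓ y) d = some y ∧ oplus x d = some (x ⊔ y)

/-- A block: a maximal set of pairwise compatible elements. -/
def IsBlock {E : Type u} [LatticeEffectAlgebra E] (M : Set E) : Prop :=
  Maximal (fun S : Set E => ∀ x ∈ S, ∀ y ∈ S, Compatible x y) M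

def BlockFinite (E : Type u) [LatticeEffectAlgebra E] : Prop :=
  {M : Set E | IsBlock M}.Finite

/-- For every atom `a`, only finitely many atoms `b` satisfy `b ≰ a'`. -/
def AlmostOrthogonal (E : Type u) [LatticeEffectAlgebra E] : Prop :=
  ∀ a : E, IsAtom a → {b : E | IsAtom b ∧ ¬ b ≤ orthosupplement a}.Finite

/-- The set of all `l a`, where `a` is an atom and `l ≥ 1` is such that `l a` exists
(that is, `1 ≤ l ≤ ord a`). -/
def atomMultiples (E : Type u) [LatticeEffectAlgebra E] : Set E :=
  {y | ∃ (a : E) (l : ℕ), IsAtom a ∧ 1 ≤ l ∧ multiple l a = some y}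

/-- `𝒰`: all finite joins of elements `l a` with `a` an atom. -/
def joinsOfAtomMultiples (E : Type u) [LatticeEffectAlgebra E] : Set E :=
  {x | ∃ F : Finset E, (F : Set E) ⊆ atomMultiples E ∧ IsLUB (F : Set E) x}

/-- The function family `Φ`: the indicator functions of the up-sets `{x | u ≤ x}` for `u ∈ 𝒰`
and of the down-sets `{x | x ≤ v}` for `v' ∈ 𝒰`. -/
noncomputable def separatingFamily (E : Type u) [LatticeEffectAlgebra E] : Set (E → ℝ) :=
  {f | ∃ w ∈ joinsOfAtomMultiples E, f = (Ici w).indicator 1} ∪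
    {f | ∃ v : E, orthosupplement v ∈ joinsOfAtomMultiples E ∧ f = (Iic v).indicator 1}

/-- The uniformity induced by the pseudometrics `|φ a - φ b|`, `φ ∈ Φ`. -/
@[reducible] noncomputable def uniformityPhi (E : Type u) [LatticeEffectAlgebra E] : UniformSpace E :=
  ⨅ φ ∈ separatingFamily E, UniformSpace.comap φ inferInstance

/-- The topology `τ_Φ` of that uniformity. -/
@[reducible] noncomputable def tauPhi (E : Type u) [LatticeEffectAlgebra E] : TopologicalSpace E :=
  (uniformityPhi E).toTopologicalSpace

end LatticeEffectAlgebra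

namespace OrderNet

/-- Order convergence of the net `x` to `a`: there are nets `v ≤ x ≤ w` over the same directed
set with `v ↑ a` and `w ↓ a`. -/
def OrderConverges {L : Type u} [PartialOrder L] {ι : Type u} [Preorder ι]
    (x : ι → L) (a : L) : Prop :=
  ∃ v w : ι → L, Monotone v ∧ IsLUB (range v) a ∧ Antitone w ∧ IsGLB (range w) a ∧
    ∀ i, v i ≤ x i ∧ x i ≤ w i

/-- The order topology `τ_o`: `U` is open iff every net that order converges to a point of `U`
is eventually in `U`. By the two lemmas that follow, it is the finest topology in which order
convergence implies convergence. -/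
@[reducible] def tauO (L : Type u) [PartialOrder L] : TopologicalSpace L where
  IsOpen U := ∀ (ι : Type u) [Preorder ι] [IsDirectedOrder ι] [Nonempty ι] (x : ι → L) (a : L),
    OrderConverges x a → a ∈ U → ∀ᶠ i in atTop, x i ∈ U
  isOpen_univ := fun _ _ _ _ _ _ _ _ => Eventually.of_forall fun _ => mem_univ _
  isOpen_inter := fun _ _ hs ht ι _ _ _ x a hx ha =>
    (hs ι x a hx ha.1).and (ht ι x a hx ha.2)
  isOpen_sUnion := fun _ hS ι _ _ _ x a hx ⟨t, htS, hat⟩ =>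
    (hS t htS ι x a hx hat).mono fun _ hi => ⟨t, htS, hi⟩

theorem tendsto_tauO {L : Type u} [PartialOrder L] (ι : Type u) [Preorder ι]
    [IsDirectedOrder ι] [Nonempty ι] (x : ι → L) (a : L) (h : OrderConverges x a) :
    Tendsto x atTop (@nhds L (tauO L) a) := by
  let _ := tauO L
  rw [tendsto_nhds]
  intro U hU ha
  exact hU ι x a h ha

/-- In Mathlib `t₁ ≤ t₂` says that `t₁` is finer than `t₂`. -/
theorem tauO_le {L : Type u} [PartialOrder L] (τ : TopologicalSpace L)
    (h : ∀ (ι : Type u) [Preorder ι] [IsDirectedOrder ι] [Nonempty ι] (x : ι → L) (a : L),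
      OrderConverges x a → Tendsto x atTop (@nhds L τ a)) : tauO L ≤ τ := by
  intro U hU ι _ _ _ x a hx ha
  exact h ι x a hx (hU.mem_nhds ha)

/-- Convergence of nets in `τ_o` coincides with order convergence. -/
def OrderConvergenceIsTopological (L : Type u) [PartialOrder L] : Prop :=
  ∀ (ι : Type u) [Preorder ι] [IsDirectedOrder ι] [Nonempty ι] (x : ι → L) (a : L),
    Tendsto x atTop (@nhds L (tauO L) a) ↔ OrderConverges x a

/-- The interval topology `τ_i`: the closed intervals `[a, b]` with `a ≤ b` form a closed
subbasis. -/
@[reducible] def tauI (L : Type u) [PartialOrder L] : TopologicalSpace L :=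
  TopologicalSpace.generateFrom {U | ∃ a b : L, a ≤ b ∧ U = (Icc a b)ᶜ}

/-- (o)-continuity of a lattice: `x_i ↑ a` implies `x_i ∧ y ↑ a ∧ y` for every `y`. -/
def OContinuous (L : Type u) [Lattice L] : Prop :=
  ∀ (ι : Type u) [Preorder ι] [IsDirectedOrder ι] [Nonempty ι] (x : ι → L) (a y : L),
    Monotone x → IsLUB (range x) a → IsLUB (range fun i => x i ⊓ y) (a ⊓ y)

/-- `a` is compact: if `a ≤ ⋁ D` (where `⋁ D` exists), then `a ≤ ⋁ F` for some finite
`F ⊆ D`. -/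
def IsCompactElt {L : Type u} [Lattice L] (a : L) : Prop :=
  ∀ (D : Set L) (d : L), IsLUB D d → a ≤ d →
    ∃ F : Finset L, (F : Set L) ⊆ D ∧ ∃ s : L, IsLUB (F : Set L) s ∧ a ≤ s

/-- Every element is a join of compact elements. -/
def CompactlyGenerated (L : Type u) [Lattice L] : Prop :=
  ∀ x : L, ∃ S : Set L, (∀ c ∈ S, IsCompactElt c) ∧ IsLUB S x

end OrderNet

open scoped Topology

namespace LatticeEffectAlgebra

open EffectAlgebra OrderNet

/-! Every element is the join of the atom multiples `la` below it (`isLUB_atomMultiples`). Passing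
to supplements, `y ≰ x` means `x ≤ z'` for some atom multiple `z` not orthogonal to `y`
(`not_le_iff_exists_orthosupplement`). Almost orthogonality leaves, for an atom multiple `y`, only
finitely many candidates `z`. This finiteness makes atom multiples compact, and it makes the sets
`↑y` and `↓y'` clopen in `τ_i`. The clopen sets identify `τ_i` with `τ_Φ`, and they make the meets
and joins of tails of a `τ_i`-convergent net squeeze it to its limit, so that `τ_i = τ_o`.

Compact generation gives (o)-continuity in any lattice. Conversely, if infinitely many atoms are not
orthogonal to an atom `a`, block-finiteness puts infinitely many of them into one block. The
supplements of the tails of their join increase to `1`, yet each meets `a` in `0`, against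
(o)-continuity. Finally, if `τ_i = τ_Φ`, then `↑a` is `τ_i`-open around `1`, so finitely many proper
principal ideals cover its complement, and these determine every atom not orthogonal to `a`. -/

theorem inf_eq_bot_of_not_le {L : Type u} [Lattice L] [OrderBot L] {a x : L} (ha : IsAtom a)
    (h : ¬ a ≤ x) : a ⊓ x = ⊥ :=
  (ha.le_iff.1 inf_le_left).resolve_right fun hax => h (inf_eq_left.1 hax)

theorem inf_eq_bot_of_isAtom {L : Type u} [Lattice L] [OrderBot L] {a b : L} (ha : IsAtom a)
    (hb : IsAtom b) (hne : a ≠ b) : a ⊓ b = ⊥ :=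
  inf_eq_bot_of_not_le ha fun h => (hb.le_iff.1 h).elim ha.1 hne

/-! ### Arithmetic of the partial sum and the supplement -/

section Arithmetic

variable {E : Type u}

theorem exists_oplus_of_assoc [EffectAlgebra E] {a b c s r : E} (h1 : oplus a b = some s)
    (h2 : oplus s c = some r) : ∃ t, oplus b c = some t ∧ oplus a t = some r := by
  have h := oplus_assoc a b c
  rw [h1, Option.bind_some, h2] at h
  exact Option.bind_eq_some_iff.1 h.symm

theorem exists_oplus_of_assoc' [EffectAlgebra E] {a b c t r : E} (h1 : oplus b c = some t)
    (h2 : oplus a t = some r) : ∃ s, oplus a b = some s ∧ oplus s c = some r := by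
  have h := oplus_assoc a b c
  rw [h1, Option.bind_some, h2] at h
  exact Option.bind_eq_some_iff.1 h

theorem eq_orthosupplement [EffectAlgebra E] {a b : E} (h : oplus a b = some 1) :
    b = orthosupplement a :=
  (existsUnique_orthosupplement a).unique h (oplus_orthosupplement a)

theorem orthosupplement_orthosupplement [EffectAlgebra E] (a : E) :
    orthosupplement (orthosupplement a) = a := by
  refine (eq_orthosupplement ?_).symm
  rw [oplus_comm]
  exact oplus_orthosupplement a

/-- Adding `c'` on the left turns both sums into `1`, so `b` and `d` are both the supplement of `c'
⊕ a`. -/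
theorem oplus_left_cancel [EffectAlgebra E] {a b c d : E} (hb : oplus a b = some c)
    (hd : oplus a d = some c) : b = d := by
  have key : ∀ x, oplus a x = some c →
      ∃ t, oplus (orthosupplement c) a = some t ∧ oplus t x = some 1 := by
    intro x hx
    refine exists_oplus_of_assoc' hx ?_
    rw [oplus_comm]
    exact oplus_orthosupplement c
  obtain ⟨t, ht, htb⟩ := key b hb
  obtain ⟨t', ht', htd⟩ := key d hd
  obtain rfl : t = t' := Option.some.inj (ht.symm.trans ht')
  rw [eq_orthosupplement htb, eq_orthosupplement htd]

variable [LatticeEffectAlgebra E]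

theorem le_of_oplus {a b c : E} (h : oplus a b = some c) : a ≤ c :=
  (le_iff_exists_oplus a c).2 ⟨b, h⟩

theorem le_of_oplus' {a b c : E} (h : oplus a b = some c) : b ≤ c := by
  rw [oplus_comm] at h
  exact le_of_oplus h

theorem le_orthosupplement_iff {a b : E} :
    a ≤ orthosupplement b ↔ ∃ c, oplus a b = some c := by
  constructor
  · intro h
    obtain ⟨d, hd⟩ := (le_iff_exists_oplus _ _).1 h
    rw [oplus_comm] at hd
    have h1 := oplus_orthosupplement b
    rw [oplus_comm] at h1
    obtain ⟨t, ht, -⟩ := exists_oplus_of_assoc hd h1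
    exact ⟨t, ht⟩
  · rintro ⟨c, hc⟩
    rw [oplus_comm] at hc
    obtain ⟨t, ht, hbt⟩ := exists_oplus_of_assoc hc (oplus_orthosupplement c)
    rw [← eq_orthosupplement hbt]
    exact le_of_oplus ht

theorem le_orthosupplement_comm {a b : E} :
    a ≤ orthosupplement b ↔ b ≤ orthosupplement a := by
  rw [le_orthosupplement_iff, le_orthosupplement_iff, oplus_comm]

theorem orthosupplement_anti {a b : E} (h : a ≤ b) :
    orthosupplement b ≤ orthosupplement a := by
  rw [le_orthosupplement_comm, orthosupplement_orthosupplement]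
  exact h

theorem orthosupplement_le_comm {a b : E} :
    orthosupplement a ≤ b ↔ orthosupplement b ≤ a := by
  have h := le_orthosupplement_comm (a := orthosupplement a) (b := orthosupplement b)
  rwa [orthosupplement_orthosupplement, orthosupplement_orthosupplement] at h

theorem orthosupplement_bot : orthosupplement (⊥ : E) = ⊤ := by
  refine (eq_orthosupplement ?_).symm
  rw [oplus_comm]
  exact oplus_zero _

/-- `b ≤ s ⊖ a` iff `a ⊕ b` is defined and below `s`, where `d = s ⊖ a`. -/
theorem le_diff_iff {a b d s : E} (hd : oplus a d = some s) :
    b ≤ d ↔ ∃ c, oplus a b = some c ∧ c ≤ s := by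
  constructor
  · intro h
    obtain ⟨e, he⟩ := (le_iff_exists_oplus _ _).1 h
    obtain ⟨c, hc, hce⟩ := exists_oplus_of_assoc' he hd
    exact ⟨c, hc, le_of_oplus hce⟩
  · rintro ⟨c, hc, hcs⟩
    obtain ⟨e, he⟩ := (le_iff_exists_oplus _ _).1 hcs
    obtain ⟨t, ht, hat⟩ := exists_oplus_of_assoc hc he
    rw [oplus_left_cancel hd hat]
    exact le_of_oplus ht

/-- The common end of the arguments that show `s ≤ s ⊖ a` for a join `s`. -/
theorem eq_bot_of_oplus_le {a s c : E} (h : oplus a s = some c) (hc : c ≤ s) : a = ⊥ := by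
  have hcs : c = s := le_antisymm hc (le_of_oplus' h)
  rw [hcs, oplus_comm] at h
  exact oplus_left_cancel h (oplus_zero s)

/-- Disjoint orthogonal elements have their sum as join. -/
theorem sup_eq_of_oplus {a b e : E} (h : oplus a b = some e) (hab : a ⊓ b = ⊥) :
    a ⊔ b = e := by
  have hle : a ⊔ b ≤ e := sup_le (le_of_oplus h) (le_of_oplus' h)
  -- The remainder `f = e ⊖ (a ∨ b)` lies below both `e ⊖ a = b` and `e ⊖ b = a`, hence vanishes.
  obtain ⟨f, hf⟩ := (le_iff_exists_oplus _ _).1 hle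
  have hf' := hf
  rw [oplus_comm] at hf'
  have hfb : f ≤ b := by
    rw [le_diff_iff h, oplus_comm]
    exact (le_diff_iff hf').1 le_sup_left
  have hfa : f ≤ a := by
    rw [oplus_comm] at h
    rw [le_diff_iff h, oplus_comm]
    exact (le_diff_iff hf').1 le_sup_right
  have hbot : f = ⊥ := le_bot_iff.1 (hab ▸ le_inf hfa hfb)
  rw [hbot] at hf
  exact Option.some.inj ((oplus_zero _).symm.trans hf)

/-- If `a ⊕ z` and `b ⊕ z` are defined with `a`, `b` disjoint and orthogonal, then `b` is
orthogonal to `z ⊕ a`. -/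
theorem le_orthosupplement_oplus {a b z s : E} (hab : a ≤ orthosupplement b) (hdisj : a ⊓ b = ⊥)
    (hza : oplus z a = some s) (hzb : b ≤ orthosupplement z) : b ≤ orthosupplement s := by
  obtain ⟨e, he⟩ := le_orthosupplement_iff.1 hab
  have haz : a ≤ orthosupplement z := by
    rw [le_orthosupplement_iff]
    exact ⟨s, by rw [oplus_comm]; exact hza⟩
  -- Disjointness makes `a ⊕ b` the join, so it is orthogonal to `z` as soon as both summands are.
  have hez : e ≤ orthosupplement z := sup_eq_of_oplus he hdisj ▸ sup_le haz hzb
  obtain ⟨r, hr⟩ := le_orthosupplement_iff.1 hez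
  rw [oplus_comm] at hr
  obtain ⟨s', hs', hr'⟩ := exists_oplus_of_assoc' he hr
  obtain rfl : s' = s := Option.some.inj (hs'.symm.trans hza)
  rw [le_orthosupplement_comm, le_orthosupplement_iff]
  exact ⟨r, hr'⟩

end Arithmetic

/-! ### Multiples of atoms -/

section Multiples

variable {E : Type u} [LatticeEffectAlgebra E]

theorem multiple_succ_eq_some {n : ℕ} {a s : E} :
    multiple (n + 1) a = some s ↔ ∃ t, multiple n a = some t ∧ oplus t a = some s :=
  Option.bind_eq_some_iff

theorem multiple_one (a : E) : multiple 1 a = some a := by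
  refine multiple_succ_eq_some.2 ⟨0, rfl, ?_⟩
  rw [oplus_comm]
  exact oplus_zero a

theorem multiple_isSome_of_le {m n : ℕ} {a : E} (hmn : m ≤ n) (h : (multiple n a).isSome) :
    (multiple m a).isSome := by
  induction n, hmn using Nat.le_induction with
  | base => exact h
  | succ n _ ih =>
    obtain ⟨s, hs⟩ := Option.isSome_iff_exists.1 h
    obtain ⟨t, ht, -⟩ := multiple_succ_eq_some.1 hs
    exact ih (by rw [ht]; rfl)

/-- Archimedean property: if all multiples existed, with join `s`, then `(n+1)a ≤ s` would give `na
≤ s ⊖ a` for all `n`, hence `s ≤ s ⊖ a`. -/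
theorem exists_multiple_eq_none (hcomplete : ∀ S : Set E, ∃ s : E, IsLUB S s) {a : E}
    (ha : a ≠ ⊥) : ∃ n, multiple n a = none := by
  by_contra! hne
  obtain ⟨s, hs⟩ := hcomplete {y | ∃ n, multiple n a = some y}
  have has : a ≤ s := hs.1 ⟨1, multiple_one a⟩
  obtain ⟨d, hd⟩ := (le_iff_exists_oplus _ _).1 has
  have hsd : s ≤ d := by
    refine hs.2 ?_
    rintro y ⟨n, hn⟩
    obtain ⟨z, hz⟩ := Option.ne_none_iff_exists'.1 (hne (n + 1))
    obtain ⟨t, ht, htz⟩ := multiple_succ_eq_some.1 hz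
    obtain rfl : t = y := Option.some.inj (ht.symm.trans hn)
    rw [le_diff_iff hd, oplus_comm]
    exact ⟨z, htz, hs.1 ⟨n + 1, hz⟩⟩
  obtain ⟨c, hc, hcs⟩ := (le_diff_iff hd).1 hsd
  exact ha (eq_bot_of_oplus_le hc hcs)

theorem finite_multiples (hcomplete : ∀ S : Set E, ∃ s : E, IsLUB S s) {a : E} (ha : a ≠ ⊥) :
    {y : E | ∃ n, multiple n a = some y}.Finite := by
  obtain ⟨N, hN⟩ := exists_multiple_eq_none hcomplete ha
  refine ((Set.finite_Iio N).image fun n => (multiple n a).getD 0).subset ?_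
  rintro y ⟨n, hn⟩
  refine ⟨n, ?_, by simp [hn]⟩
  by_contra hlt
  have := multiple_isSome_of_le (not_lt.1 hlt) (by rw [hn]; rfl : (multiple n a).isSome)
  rw [hN] at this
  exact Bool.noConfusion this

/-- Every element is the join of the multiples of atoms below it. -/
theorem isLUB_atomMultiples (hcomplete : ∀ S : Set E, ∃ s : E, IsLUB S s) (hatomic : IsAtomic E)
    (x : E) : IsLUB {y | y ∈ atomMultiples E ∧ y ≤ x} x := by
  obtain ⟨s, hs⟩ := hcomplete {y | y ∈ atomMultiples E ∧ y ≤ x}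
  have hsx : s ≤ x := hs.2 fun y hy => hy.2
  obtain ⟨d, hd⟩ := (le_iff_exists_oplus _ _).1 hsx
  rcases hatomic.eq_bot_or_exists_atom_le d with hbot | ⟨a, ha, had⟩
  · rw [hbot] at hd
    obtain rfl : s = x := Option.some.inj ((oplus_zero s).symm.trans hd)
    exact hs
  exfalso
  obtain ⟨e, hse, hex⟩ := (le_diff_iff hd).1 had
  -- An atom `a` below `x ⊖ s` can be added forever: if `na ≤ s`, then `(n+1)a` exists and is at
  -- most `s ⊕ a ≤ x`, so it is among the elements joined to form `s`.
  have hall : ∀ n, ∃ y, multiple n a = some y ∧ y ≤ s := by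
    intro n
    induction n with
    | zero => exact ⟨0, rfl, bot_le⟩
    | succ n ih =>
      obtain ⟨y, hy, hys⟩ := ih
      have has := hse
      rw [oplus_comm] at has
      obtain ⟨z, hz, hze⟩ := (le_diff_iff has).1 hys
      rw [oplus_comm] at hz
      have hmul : multiple (n + 1) a = some z := multiple_succ_eq_some.2 ⟨y, hy, hz⟩
      exact ⟨z, hmul, hs.1 ⟨⟨a, n + 1, ha, Nat.le_add_left 1 n, hmul⟩, hze.trans hex⟩⟩
  obtain ⟨N, hN⟩ := exists_multiple_eq_none hcomplete ha.1
  obtain ⟨y, hy, -⟩ := hall N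
  exact Option.some_ne_none y (hy.symm.trans hN)

theorem atom_le_orthosupplement_multiple {a b y : E} {n : ℕ} (ha : IsAtom a) (hb : IsAtom b)
    (hne : a ≠ b) (hab : a ≤ orthosupplement b) (hy : multiple n a = some y) :
    b ≤ orthosupplement y := by
  induction n generalizing y with
  | zero =>
    obtain rfl : (0 : E) = y := Option.some.inj hy
    exact (orthosupplement_bot (E := E)) ▸ le_top
  | succ n ih =>
    obtain ⟨t, ht, hty⟩ := multiple_succ_eq_some.1 hy
    exact le_orthosupplement_oplus hab (inf_eq_bot_of_isAtom ha hb hne) hty (ih ht)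

/-- If `b ≤ a ⊕ t`, then `a ⊕ b = a ∨ b ≤ a ⊕ t`, and cancelling `a` gives `b ≤ t`; so the multiple
can be lowered down to `0`. -/
theorem not_atom_le_multiple {a b y : E} {n : ℕ} (ha : IsAtom a) (hb : IsAtom b)
    (hne : a ≠ b) (hab : a ≤ orthosupplement b) (hy : multiple n a = some y) : ¬ b ≤ y := by
  induction n generalizing y with
  | zero =>
    obtain rfl : (0 : E) = y := Option.some.inj hy
    exact fun h => hb.1 (le_bot_iff.1 h)
  | succ n ih =>
    obtain ⟨t, ht, hty⟩ := multiple_succ_eq_some.1 hy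
    intro hby
    refine ih ht ?_
    obtain ⟨e, he⟩ := le_orthosupplement_iff.1 hab
    rw [oplus_comm] at hty
    rw [le_diff_iff hty]
    refine ⟨e, he, ?_⟩
    rw [← sup_eq_of_oplus he (inf_eq_bot_of_isAtom ha hb hne)]
    exact sup_le (le_of_oplus hty) hby

/-- Multiples of distinct orthogonal atoms are orthogonal. -/
theorem multiple_le_orthosupplement_multiple {a b y z : E} {n m : ℕ} (ha : IsAtom a)
    (hb : IsAtom b) (hne : a ≠ b) (hab : a ≤ orthosupplement b) (hy : multiple n a = some y)
    (hz : multiple m b = some z) : y ≤ orthosupplement z := by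
  induction m generalizing z with
  | zero =>
    obtain rfl : (0 : E) = z := Option.some.inj hz
    exact (orthosupplement_bot (E := E)) ▸ le_top
  | succ m ih =>
    obtain ⟨t, ht, htz⟩ := multiple_succ_eq_some.1 hz
    refine le_orthosupplement_oplus (atom_le_orthosupplement_multiple ha hb hne hab hy) ?_ htz
      (ih ht)
    exact inf_eq_bot_of_not_le hb (not_atom_le_multiple ha hb hne hab hy)

/-- In an almost orthogonal algebra a multiple of an atom is not orthogonal to only finitely many
multiples of atoms. -/
theorem AlmostOrthogonal.finite_not_orthogonal (hE : AlmostOrthogonal E)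
    (hcomplete : ∀ S : Set E, ∃ s : E, IsLUB S s) {y : E} (hy : y ∈ atomMultiples E) :
    {z | z ∈ atomMultiples E ∧ ¬ z ≤ orthosupplement y}.Finite := by
  obtain ⟨a, n, ha, -, hay⟩ := hy
  -- `a` is inserted because orthogonality passes to multiples only for distinct atoms: multiples of
  -- `a` may fail to be orthogonal even if `a ≤ a'`.
  have hfin : (insert a {b : E | IsAtom b ∧ ¬ b ≤ orthosupplement a}).Finite := (hE a ha).insert a
  refine (hfin.biUnion (t := fun b => {z : E | IsAtom b ∧ ∃ m, multiple m b = some z})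
    fun b _ => ?_).subset ?_
  · by_cases hb : IsAtom b
    · exact (finite_multiples hcomplete hb.1).subset fun z hz => hz.2
    · exact Set.finite_empty.subset fun z hz => hb hz.1
  · rintro z ⟨⟨b, m, hb, -, hbz⟩, hz⟩
    refine mem_biUnion (x := b) ?_ ⟨hb, m, hbz⟩
    by_cases hba : b = a
    · exact Or.inl hba
    · refine Or.inr ⟨hb, fun h => hz ?_⟩
      exact multiple_le_orthosupplement_multiple hb ha hba h hbz hay

theorem not_le_orthosupplement_iff (hcomplete : ∀ S : Set E, ∃ s : E, IsLUB S s)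
    (hatomic : IsAtomic E) {x y : E} : ¬ x ≤ orthosupplement y ↔
      ∃ z, (z ∈ atomMultiples E ∧ ¬ z ≤ orthosupplement y) ∧ z ≤ x := by
  constructor
  · intro h
    by_contra! hz
    refine h ((isLUB_atomMultiples hcomplete hatomic x).2 fun z hzx => ?_)
    by_contra hzy
    exact hz z ⟨hzx.1, hzy⟩ hzx.2
  · rintro ⟨z, hz, hzx⟩ h
    exact hz.2 (hzx.trans h)

theorem not_le_iff_exists_orthosupplement (hcomplete : ∀ S : Set E, ∃ s : E, IsLUB S s)
    (hatomic : IsAtomic E) {x y : E} : ¬ y ≤ x ↔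
      ∃ z, (z ∈ atomMultiples E ∧ ¬ z ≤ orthosupplement y) ∧ x ≤ orthosupplement z := by
  have h := not_le_orthosupplement_iff hcomplete hatomic (x := orthosupplement x) (y := y)
  rw [le_orthosupplement_comm, orthosupplement_orthosupplement] at h
  simpa only [le_orthosupplement_comm (b := x)] using h

end Multiples

/-! ### Compactness of atom multiples -/

section CompactlyGenerated

variable {E : Type u} [LatticeEffectAlgebra E]

theorem AlmostOrthogonal.isCompactElt (hE : AlmostOrthogonal E)
    (hcomplete : ∀ S : Set E, ∃ s : E, IsLUB S s) (hatomic : IsAtomic E) {y : E}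
    (hy : y ∈ atomMultiples E) : IsCompactElt y := by
  classical
  intro D d hD hyd
  by_contra! hF
  have hN := hE.finite_not_orthogonal hcomplete hy
  -- Each of the finitely many obstructions `z` to `y ≤ d` is defeated by one member of `D`; these
  -- members form the finite subset.
  have hall : ∀ z, (z ∈ atomMultiples E ∧ ¬ z ≤ orthosupplement y) →
      ∃ e ∈ D, ¬ e ≤ orthosupplement z := by
    intro z hz
    by_contra! hle
    exact (not_le_iff_exists_orthosupplement hcomplete hatomic).2 ⟨z, hz, hD.2 hle⟩ hyd
  choose! f hfD hf using hall
  have hFD : ((hN.toFinset.image f : Finset E) : Set E) ⊆ D := by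
    intro e he
    obtain ⟨z, hz, rfl⟩ := Finset.mem_image.1 (Finset.mem_coe.1 he)
    exact hfD z (hN.mem_toFinset.1 hz)
  have hlub := Finset.isLUB_sup_id (s := hN.toFinset.image f)
  have hnot := hF _ hFD _ hlub
  obtain ⟨z, hz, hle⟩ := (not_le_iff_exists_orthosupplement hcomplete hatomic).1 hnot
  refine hf z hz (le_trans (hlub.1 ?_) hle)
  exact Finset.mem_coe.2 (Finset.mem_image_of_mem f (hN.mem_toFinset.2 hz))

theorem AlmostOrthogonal.compactlyGenerated (hE : AlmostOrthogonal E)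
    (hcomplete : ∀ S : Set E, ∃ s : E, IsLUB S s) (hatomic : IsAtomic E) :
    CompactlyGenerated E := fun x =>
  ⟨_, fun _ hc => hE.isCompactElt hcomplete hatomic hc.1, isLUB_atomMultiples hcomplete hatomic x⟩

end CompactlyGenerated

end LatticeEffectAlgebra

/-! ### Order convergence and interval topology in general orders -/

namespace OrderNet

theorem CompactlyGenerated.oContinuous {L : Type u} [Lattice L] (h : CompactlyGenerated L) :
    OContinuous L := by
  classical
  intro ι _ _ _ x a y hx ha
  refine ⟨?_, fun t ht => ?_⟩
  · rintro _ ⟨i, rfl⟩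
    exact inf_le_inf_right y (ha.1 ⟨i, rfl⟩)
  obtain ⟨S, hS, hlub⟩ := h (a ⊓ y)
  refine hlub.2 fun c hc => ?_
  have hcay : c ≤ a ⊓ y := hlub.1 hc
  obtain ⟨F, hF, s, hs, hcs⟩ := hS c hc _ a ha (hcay.trans inf_le_left)
  -- Directedness puts the finitely many terms of the net in `F` below a single term.
  have hk : ∃ k, ∀ e ∈ F, e ≤ x k := by
    choose! g hg using hF
    obtain ⟨k, hk⟩ := (F.image g).exists_le
    refine ⟨k, fun e he => ?_⟩
    rw [← hg (Finset.mem_coe.2 he)]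
    exact hx (hk _ (Finset.mem_image_of_mem g he))
  obtain ⟨k, hk⟩ := hk
  exact (le_inf (hcs.trans (hs.2 hk)) (hcay.trans inf_le_right)).trans (ht ⟨k, rfl⟩)

theorem tauO_le_tauI (L : Type u) [PartialOrder L] : tauO L ≤ tauI L := by
  refine tauO_le _ fun ι _ _ _ x a ⟨v, w, hv, hva, hw, hwa, hx⟩ => ?_
  rw [TopologicalSpace.tendsto_nhds_generateFrom_iff]
  rintro _ ⟨c, d, -, rfl⟩ ha
  -- A net that is frequently in `[c, d]` forces `c ≤ w j` and `v j ≤ d` for all `j`, by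
  -- monotonicity, so its order limit lies in `[c, d]`.
  by_contra hev
  have hfreq : ∃ᶠ i in atTop, x i ∈ Icc c d := by
    intro hn
    exact hev hn
  rw [frequently_atTop] at hfreq
  refine ha ⟨hwa.2 ?_, hva.2 ?_⟩
  · rintro _ ⟨j, rfl⟩
    obtain ⟨i, hji, hi⟩ := hfreq j
    exact hi.1.trans ((hx i).2.trans (hw hji))
  · rintro _ ⟨j, rfl⟩
    obtain ⟨i, hji, hi⟩ := hfreq j
    exact (hv hji).trans ((hx i).1.trans hi.2)

/-- A topology in which convergence of nets implies order convergence is finer than the order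
topology. -/
theorem le_tauO {L : Type u} [PartialOrder L] (τ : TopologicalSpace L)
    (h : ∀ (ι : Type u) [Preorder ι] [IsDirectedOrder ι] [Nonempty ι] (x : ι → L) (a : L),
      Tendsto x atTop (@nhds L τ a) → OrderConverges x a) : τ ≤ tauO L := by
  intro U hU
  rw [isOpen_iff_mem_nhds]
  intro a ha
  by_contra hnot
  -- Points outside `U`, indexed by the neighbourhoods of `a` under reverse inclusion, form a net
  -- converging to `a`; the index type lies in the universe that `tauO` quantifies over.
  have hex : ∀ V : {V : Set L // V ∈ 𝓝 a}, ∃ y, y ∈ V.1 ∧ y ∉ U := by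
    intro V
    by_contra! hV
    exact hnot (mem_of_superset V.2 hV)
  choose f hfV hfU using hex
  have hdir : IsDirectedOrder {V : Set L // V ∈ 𝓝 a}ᵒᵈ :=
    ⟨fun V W => ⟨OrderDual.toDual ⟨_, inter_mem (OrderDual.ofDual V).2 (OrderDual.ofDual W).2⟩,
      inter_subset_left, inter_subset_right⟩⟩
  have hne : Nonempty {V : Set L // V ∈ 𝓝 a}ᵒᵈ := ⟨OrderDual.toDual ⟨univ, univ_mem⟩⟩
  have htend : Tendsto (fun V : {V : Set L // V ∈ 𝓝 a}ᵒᵈ => f (OrderDual.ofDual V)) atTop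
      (𝓝 a) := by
    intro W hW
    refine mem_map.2 (mem_atTop_sets.2 ⟨OrderDual.toDual ⟨W, hW⟩, fun V hV => ?_⟩)
    exact hV (hfV _)
  obtain ⟨V, hV⟩ := (hU _ _ a (h _ _ a htend) ha).exists
  exact hfU _ hV

/-- The complement of a neighbourhood of the top in the interval topology is covered by finitely
many principal ideals of elements below the top. -/
theorem exists_finite_of_isOpen_tauI {L : Type u} [PartialOrder L] [OrderTop L] {U : Set L}
    (hU : IsOpen[tauI L] U) (htop : ⊤ ∈ U) :
    ∃ D : Set L, D.Finite ∧ ⊤ ∉ D ∧ ∀ x ∉ U, ∃ d ∈ D, x ≤ d := by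
  induction hU with
  | basic U hU =>
    obtain ⟨c, d, hcd, rfl⟩ := hU
    refine ⟨{d}, finite_singleton d, ?_, fun x hx => ⟨d, rfl, ?_⟩⟩
    · intro hd
      exact htop ⟨le_top, (mem_singleton_iff.1 hd).le⟩
    · exact (not_not.1 hx).2
  | univ => exact ⟨∅, finite_empty, notMem_empty _, fun x hx => (hx (mem_univ x)).elim⟩
  | inter U V _ _ ihU ihV =>
    obtain ⟨C, hC, hC', hCx⟩ := ihU htop.1
    obtain ⟨D, hD, hD', hDx⟩ := ihV htop.2
    refine ⟨C ∪ D, hC.union hD, fun h => h.elim hC' hD', fun x hx => ?_⟩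
    by_cases hxU : x ∈ U
    · obtain ⟨d, hd, hxd⟩ := hDx x fun hxV => hx ⟨hxU, hxV⟩
      exact ⟨d, Or.inr hd, hxd⟩
    · obtain ⟨d, hd, hxd⟩ := hCx x hxU
      exact ⟨d, Or.inl hd, hxd⟩
  | sUnion S _ ih =>
    obtain ⟨U, hUS, hU⟩ := htop
    obtain ⟨D, hD, hD', hDx⟩ := ih U hUS hU
    exact ⟨D, hD, hD', fun x hx => hDx x fun hxU => hx ⟨U, hUS, hxU⟩⟩

end OrderNet

namespace LatticeEffectAlgebra

open EffectAlgebra OrderNet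

variable {E : Type u} [LatticeEffectAlgebra E]

/-! ### Blocks, and almost orthogonality from (o)-continuity -/

section Blocks

theorem compatible_self (x : E) : Compatible x x :=
  ⟨0, by rw [inf_idem]; exact oplus_zero x, by rw [sup_idem]; exact oplus_zero x⟩

theorem exists_isBlock_mem (x : E) : ∃ M : Set E, IsBlock M ∧ x ∈ M := by
  obtain ⟨M, hxM, hM⟩ := zorn_subset_nonempty
    {S : Set E | ∀ x ∈ S, ∀ y ∈ S, Compatible x y} (fun c hc hchain _ => by
      refine ⟨⋃₀ c, ?_, fun s hs => subset_sUnion_of_mem hs⟩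
      rintro y ⟨S, hS, hyS⟩ z ⟨T, hT, hzT⟩
      rcases hchain.total hS hT with h | h
      · exact hc hT y (h hyS) z hzT
      · exact hc hS y hyS z (h hzT)) {x} (by
      rintro y rfl z rfl
      exact compatible_self _)
  exact ⟨M, hM, hxM rfl⟩

theorem Compatible.oplus_eq_sup {a b : E} (h : Compatible a b) (hab : a ⊓ b = ⊥) :
    oplus a b = some (a ⊔ b) := by
  obtain ⟨d, hd, hd'⟩ := h
  rw [hab, oplus_comm] at hd
  obtain rfl : d = b := Option.some.inj ((oplus_zero d).symm.trans hd)
  exact hd'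

/-- The tails of the join of a set of pairwise compatible atoms have meet `0`. -/
theorem eq_bot_of_le_tails {B : Set E} (hB : ∀ b ∈ B, IsAtom b)
    (hcompat : ∀ x ∈ B, ∀ y ∈ B, Compatible x y) {c : E → E}
    (hc : ∀ b, IsLUB (B \ {b}) (c b)) {s z : E} (hs : IsLUB B s)
    (hz : ∀ b ∈ B, z ≤ c b) (hzs : z ≤ s) : z = ⊥ := by
  obtain ⟨d, hd⟩ := (le_iff_exists_oplus _ _).1 hzs
  have hsd : s ≤ d := by
    refine hs.2 fun b hb => ?_
    obtain ⟨e, he⟩ := (le_iff_exists_oplus _ _).1 (hs.1 hb)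
    -- Every other atom `q` of `B` satisfies `b ⊕ q = b ∨ q ≤ s`, so the tail omitting `b` lies
    -- below `s ⊖ b`. Hence `z ≤ s ⊖ b`, that is, `b ≤ s ⊖ z`.
    have hce : c b ≤ e := by
      refine (hc b).2 fun q hq => ?_
      rw [le_diff_iff he]
      have hne : b ≠ q := fun h => hq.2 h.symm
      exact ⟨_, (hcompat b hb q hq.1).oplus_eq_sup
        (inf_eq_bot_of_isAtom (hB b hb) (hB q hq.1) hne), sup_le (hs.1 hb) (hs.1 hq.1)⟩
    rw [le_diff_iff hd, oplus_comm]
    exact (le_diff_iff he).1 ((hz b hb).trans hce)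
  obtain ⟨r, hr, hrs⟩ := (le_diff_iff hd).1 hsd
  exact eq_bot_of_oplus_le hr hrs

theorem almostOrthogonal_of_oContinuous (hcomplete : ∀ S : Set E, ∃ s : E, IsLUB S s)
    (hblock : BlockFinite E) (h : OContinuous E) : AlmostOrthogonal E := by
  classical
  intro a ha
  by_contra hinf
  obtain ⟨M, hM, hMinf⟩ : ∃ M : Set E, IsBlock M ∧
      ({b : E | IsAtom b ∧ ¬ b ≤ orthosupplement a} ∩ M).Infinite := by
    by_contra! hfin
    refine hinf ((Set.Finite.biUnion hblock fun M hM => hfin M hM).subset ?_)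
    intro b hb
    obtain ⟨M, hM, hbM⟩ := exists_isBlock_mem b
    exact mem_biUnion hM ⟨hb, hbM⟩
  set B := {b : E | IsAtom b ∧ ¬ b ≤ orthosupplement a} ∩ M with hBdef
  choose c hc using fun F : Finset E => hcomplete (B \ F)
  have hmono : Monotone fun F : Finset E => orthosupplement (c F) := fun F G hFG =>
    orthosupplement_anti ((hc G).2 fun b hb => (hc F).1 ⟨hb.1, fun hbF => hb.2 (hFG hbF)⟩)
  have htop : IsLUB (range fun F : Finset E => orthosupplement (c F)) ⊤ := by
    refine ⟨fun _ _ => le_top, fun t ht => ?_⟩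
    have hle : ∀ F, orthosupplement t ≤ c F := fun F =>
      orthosupplement_le_comm.1 (ht ⟨F, rfl⟩)
    have hbot : orthosupplement t = ⊥ := by
      refine eq_bot_of_le_tails (B := B) (fun b hb => hb.1.1)
        (fun x hx y hy => hM.prop x hx.2 y hy.2) (c := fun b => c {b}) (s := c ∅)
        (fun b => ?_) ?_ (fun b _ => hle {b}) (hle ∅)
      · simpa using hc {b}
      · simpa using hc ∅
    rw [← orthosupplement_orthosupplement t, hbot, orthosupplement_bot]
  have hlub := h (Finset E) _ ⊤ a hmono htop
  refine ha.1 (le_bot_iff.1 ?_)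
  rw [← top_inf_eq a]
  refine hlub.2 ?_
  rintro _ ⟨F, rfl⟩
  obtain ⟨b, hb⟩ := (hMinf.sdiff F.finite_toSet).nonempty
  -- An atom `b` of `B` outside `F` is below `c F` but not below `a'`.
  have hnot : ¬ a ≤ orthosupplement (c F) := fun hle =>
    hb.1.1.2 (((hc F).1 hb).trans (le_orthosupplement_comm.1 hle))
  exact (inf_comm _ _).trans_le (inf_eq_bot_of_not_le ha hnot).le

end Blocks

/-! ### Comparison of the three topologies -/

section Topology

theorem mem_joinsOfAtomMultiples {y : E} (hy : y ∈ atomMultiples E) :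
    y ∈ joinsOfAtomMultiples E :=
  ⟨{y}, by simpa using hy, by simp⟩

/-- `τ_Φ` is the initial topology of the family `Φ`. -/
theorem le_tauPhi_iff {τ : TopologicalSpace E} :
    τ ≤ tauPhi E ↔ ∀ φ ∈ separatingFamily E, Continuous[τ, inferInstance] φ := by
  simp only [tauPhi, UniformSpace.toTopologicalSpace_iInf, le_iInf_iff,
    continuous_iff_le_induced]
  rfl

theorem isClopen_of_continuous_indicator {X : Type*} [TopologicalSpace X] {S : Set X}
    (h : Continuous (S.indicator (1 : X → ℝ))) : IsClopen S := by
  have h1 : S = S.indicator (1 : X → ℝ) ⁻¹' {1} := by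
    ext x
    by_cases hx : x ∈ S <;> simp [hx]
  have h0 : S = S.indicator (1 : X → ℝ) ⁻¹' {0}ᶜ := by
    ext x
    by_cases hx : x ∈ S <;> simp [hx]
  constructor
  · rw [h1]
    exact isClosed_singleton.preimage h
  · rw [h0]
    exact isOpen_compl_singleton.preimage h

theorem isClopen_tauPhi_Ici {w : E} (hw : w ∈ joinsOfAtomMultiples E) :
    @IsClopen E (tauPhi E) (Ici w) :=
  @isClopen_of_continuous_indicator E (tauPhi E) _ (le_tauPhi_iff.1 le_rfl _ (Or.inl ⟨w, hw, rfl⟩))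

theorem isClopen_tauPhi_Iic {w : E} (hw : w ∈ joinsOfAtomMultiples E) :
    @IsClopen E (tauPhi E) (Iic (orthosupplement w)) :=
  @isClopen_of_continuous_indicator E (tauPhi E) _ (le_tauPhi_iff.1 le_rfl _
    (Or.inr ⟨_, by rwa [orthosupplement_orthosupplement], rfl⟩))

theorem tauPhi_le_tauI (hcomplete : ∀ S : Set E, ∃ s : E, IsLUB S s) (hatomic : IsAtomic E) :
    tauPhi E ≤ tauI E := by
  refine le_generateFrom ?_
  rintro _ ⟨a, b, -, rfl⟩
  let _ := tauPhi E
  -- Writing `a` and `b'` as joins of atom multiples presents the interval as an intersection of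
  -- `τ_Φ`-clopen sets.
  have hab : Icc a b =
      (⋂ w ∈ {w | w ∈ atomMultiples E ∧ w ≤ a}, Ici w) ∩
        ⋂ w ∈ {w | w ∈ atomMultiples E ∧ w ≤ orthosupplement b}, Iic (orthosupplement w) := by
    ext x
    simp only [mem_inter_iff, mem_iInter, mem_Icc, mem_Ici, mem_Iic]
    refine and_congr (isLUB_le_iff (isLUB_atomMultiples hcomplete hatomic a)) ?_
    rw [← orthosupplement_orthosupplement b, le_orthosupplement_comm,
      isLUB_le_iff (isLUB_atomMultiples hcomplete hatomic _), orthosupplement_orthosupplement]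
    simp only [mem_upperBounds, le_orthosupplement_comm (a := x)]
  refine IsClosed.isOpen_compl (self := ?_)
  rw [hab]
  exact (isClosed_biInter fun w hw => (isClopen_tauPhi_Ici (mem_joinsOfAtomMultiples hw.1)).1).inter
    (isClosed_biInter fun w hw => (isClopen_tauPhi_Iic (mem_joinsOfAtomMultiples hw.1)).1)

theorem isClosed_tauI_Ici (a : E) : IsClosed[tauI E] (Ici a) := by
  let _ := tauI E
  refine ⟨TopologicalSpace.isOpen_generateFrom_of_mem ⟨a, ⊤, le_top, ?_⟩⟩
  rw [Icc_top]

theorem isClosed_tauI_Iic (a : E) : IsClosed[tauI E] (Iic a) := by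
  let _ := tauI E
  refine ⟨TopologicalSpace.isOpen_generateFrom_of_mem ⟨⊥, a, bot_le, ?_⟩⟩
  rw [Icc_bot]

theorem AlmostOrthogonal.isClopen_tauI_Ici (hE : AlmostOrthogonal E)
    (hcomplete : ∀ S : Set E, ∃ s : E, IsLUB S s) (hatomic : IsAtomic E) {y : E}
    (hy : y ∈ atomMultiples E) : @IsClopen E (tauI E) (Ici y) := by
  let _ := tauI E
  refine ⟨isClosed_tauI_Ici y, isClosed_compl_iff.1 ?_⟩
  have h : (Ici y)ᶜ = ⋃ z ∈ {z | z ∈ atomMultiples E ∧ ¬ z ≤ orthosupplement y},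
      Iic (orthosupplement z) := by
    ext x
    simpa using not_le_iff_exists_orthosupplement hcomplete hatomic (x := x) (y := y)
  rw [h]
  exact (hE.finite_not_orthogonal hcomplete hy).isClosed_biUnion fun z _ => isClosed_tauI_Iic _

theorem AlmostOrthogonal.isClopen_tauI_Iic (hE : AlmostOrthogonal E)
    (hcomplete : ∀ S : Set E, ∃ s : E, IsLUB S s) (hatomic : IsAtomic E) {y : E}
    (hy : y ∈ atomMultiples E) : @IsClopen E (tauI E) (Iic (orthosupplement y)) := by
  let _ := tauI E
  refine ⟨isClosed_tauI_Iic _, isClosed_compl_iff.1 ?_⟩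
  have h : (Iic (orthosupplement y))ᶜ =
      ⋃ z ∈ {z | z ∈ atomMultiples E ∧ ¬ z ≤ orthosupplement y}, Ici z := by
    ext x
    simpa using not_le_orthosupplement_iff hcomplete hatomic (x := x) (y := y)
  rw [h]
  exact (hE.finite_not_orthogonal hcomplete hy).isClosed_biUnion fun z _ => isClosed_tauI_Ici _

theorem AlmostOrthogonal.tauI_eq_tauPhi (hE : AlmostOrthogonal E)
    (hcomplete : ∀ S : Set E, ∃ s : E, IsLUB S s) (hatomic : IsAtomic E) :
    tauI E = tauPhi E := by
  refine le_antisymm (le_tauPhi_iff.2 ?_) (tauPhi_le_tauI hcomplete hatomic)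
  let _ := tauI E
  rintro φ (⟨w, ⟨F, hF, hw⟩, rfl⟩ | ⟨v, ⟨F, hF, hv⟩, rfl⟩)
  · have h : Ici w = ⋂ y ∈ F, Ici y := by
      ext x
      simpa [mem_upperBounds] using isLUB_le_iff hw (b := x)
    have hclopen : IsClopen (Ici w) := by
      rw [h]
      exact isClopen_biInter_finset fun y hy => hE.isClopen_tauI_Ici hcomplete hatomic (hF hy)
    exact continuous_one.indicator (by simp [hclopen.frontier_eq])
  · have h : Iic v = ⋂ y ∈ F, Iic (orthosupplement y) := by
      ext x
      have hx := isLUB_le_iff hv (b := orthosupplement x)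
      rw [le_orthosupplement_comm, orthosupplement_orthosupplement] at hx
      simpa [mem_upperBounds, le_orthosupplement_comm (a := x)] using hx
    have hclopen : IsClopen (Iic v) := by
      rw [h]
      exact isClopen_biInter_finset fun y hy => hE.isClopen_tauI_Iic hcomplete hatomic (hF hy)
    exact continuous_one.indicator (by simp [hclopen.frontier_eq])

theorem AlmostOrthogonal.orderConverges (hE : AlmostOrthogonal E)
    (hcomplete : ∀ S : Set E, ∃ s : E, IsLUB S s) (hatomic : IsAtomic E)
    {ι : Type u} [Preorder ι] [IsDirectedOrder ι] [Nonempty ι] {x : ι → E} {a : E}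
    (h : Tendsto x atTop (@nhds E (tauI E) a)) : OrderConverges x a := by
  let _ := tauI E
  -- `v i` and `w i` are the meet and the join of the tail of the net from `i` on.
  choose v hv using fun i => hcomplete (lowerBounds (x '' Ici i))
  choose w hw using fun i => hcomplete (x '' Ici i)
  have hv' : ∀ i, IsGLB (x '' Ici i) (v i) := fun i => isLUB_lowerBounds.1 (hv i)
  have hvx : ∀ {i j}, i ≤ j → v i ≤ x j := fun {i j} hij => (hv' i).1 ⟨j, hij, rfl⟩
  have hxw : ∀ {i j}, i ≤ j → x j ≤ w i := fun {i j} hij => (hw i).1 ⟨j, hij, rfl⟩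
  have hvw : ∀ i j, v i ≤ w j := fun i j => by
    obtain ⟨k, hik, hjk⟩ := exists_ge_ge i j
    exact (hvx hik).trans (hxw hjk)
  -- For an atom multiple `y ≤ a`, the open set `↑y` contains a tail of the net, hence `y ≤ v i` for
  -- some `i`.
  have hlow : ∀ t ∈ upperBounds (range v), a ≤ t := fun t ht => by
    refine (isLUB_atomMultiples hcomplete hatomic a).2 fun y hy => ?_
    have hev := h ((hE.isClopen_tauI_Ici hcomplete hatomic hy.1).2.mem_nhds hy.2)
    obtain ⟨i, hi⟩ := mem_atTop_sets.1 (mem_map.1 hev)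
    refine le_trans ((hv' i).2 ?_) (ht ⟨i, rfl⟩)
    rintro _ ⟨j, hj, rfl⟩
    exact hi j hj
  have hupp : ∀ t ∈ lowerBounds (range w), t ≤ a := fun t ht => by
    rw [← orthosupplement_orthosupplement a, le_orthosupplement_comm]
    refine (isLUB_atomMultiples hcomplete hatomic _).2 fun y hy => ?_
    have hev := h ((hE.isClopen_tauI_Iic hcomplete hatomic hy.1).2.mem_nhds
      (le_orthosupplement_comm.1 hy.2))
    obtain ⟨i, hi⟩ := mem_atTop_sets.1 (mem_map.1 hev)
    rw [le_orthosupplement_comm]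
    refine le_trans (ht ⟨i, rfl⟩) ((hw i).2 ?_)
    rintro _ ⟨j, hj, rfl⟩
    exact hi j hj
  -- The remaining bounds cross over: each `v i` is a lower bound of all `w j`, so `hupp` gives `v i
  -- ≤ a`, and dually.
  refine ⟨v, w, ?_, ⟨?_, hlow⟩, ?_, ⟨?_, hupp⟩, fun i => ⟨hvx le_rfl, hxw le_rfl⟩⟩
  · exact fun i j hij => (hv' j).mono (hv' i) (image_mono (Ici_subset_Ici.2 hij))
  · rintro _ ⟨i, rfl⟩
    exact hupp _ (by rintro _ ⟨j, rfl⟩; exact hvw i j)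
  · exact fun i j hij => (hw j).mono (hw i) (image_mono (Ici_subset_Ici.2 hij))
  · rintro _ ⟨i, rfl⟩
    exact hlow _ (by rintro _ ⟨j, rfl⟩; exact hvw j i)

theorem AlmostOrthogonal.tauI_eq_tauO (hE : AlmostOrthogonal E)
    (hcomplete : ∀ S : Set E, ∃ s : E, IsLUB S s) (hatomic : IsAtomic E) :
    tauI E = tauO E :=
  le_antisymm (le_tauO _ fun _ _ _ _ _ _ h => hE.orderConverges hcomplete hatomic h)
    (tauO_le_tauI E)

theorem AlmostOrthogonal.orderConvergenceIsTopological (hE : AlmostOrthogonal E)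
    (hcomplete : ∀ S : Set E, ∃ s : E, IsLUB S s) (hatomic : IsAtomic E) :
    OrderConvergenceIsTopological E := fun ι _ _ _ x a =>
  ⟨fun h => hE.orderConverges hcomplete hatomic (by rwa [hE.tauI_eq_tauO hcomplete hatomic]),
    tendsto_tauO ι x a⟩

theorem almostOrthogonal_of_tauI_eq_tauPhi (h : tauI E = tauPhi E) : AlmostOrthogonal E := by
  intro a ha
  have hmem : a ∈ joinsOfAtomMultiples E :=
    mem_joinsOfAtomMultiples ⟨a, 1, ha, le_rfl, multiple_one a⟩
  have hopen : IsOpen[tauI E] (Ici a) := by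
    rw [h]
    exact (isClopen_tauPhi_Ici hmem).2
  obtain ⟨D, hD, htop, hDx⟩ := exists_finite_of_isOpen_tauI hopen (mem_Ici.2 le_top)
  refine (hD.image orthosupplement).subset ?_
  rintro b ⟨hb, hba⟩
  -- From `b' ≤ d ≠ 1` it follows that `0 ≠ d' ≤ b`, so the atom `b` equals `d'`.
  obtain ⟨d, hd, hbd⟩ := hDx (orthosupplement b) fun hle => hba (le_orthosupplement_comm.1 hle)
  refine ⟨d, hd, (hb.le_iff.1 (orthosupplement_le_comm.1 hbd)).resolve_left fun hbot => htop ?_⟩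
  rwa [← orthosupplement_orthosupplement d, hbot, orthosupplement_bot] at hd

end Topology

end LatticeEffectAlgebra

theorem mainTheorem6 (E : Type u) [LatticeEffectAlgebra E]
    (hcomplete : ∀ S : Set E, ∃ s : E, IsLUB S s) (hatomic : IsAtomic E)
    (hblock : LatticeEffectAlgebra.BlockFinite E) :
    List.TFAE
      [LatticeEffectAlgebra.AlmostOrthogonal E,
       OrderNet.CompactlyGenerated E,
       OrderNet.OContinuous E,
       OrderNet.tauI E = OrderNet.tauO E ∧
         OrderNet.tauO E = LatticeEffectAlgebra.tauPhi E ∧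
         OrderNet.OrderConvergenceIsTopological E] := by
  tfae_have 1 → 2 := fun h => h.compactlyGenerated hcomplete hatomic
  tfae_have 2 → 3 := fun h => h.oContinuous
  tfae_have 3 → 1 := LatticeEffectAlgebra.almostOrthogonal_of_oContinuous hcomplete hblock
  tfae_have 1 → 4 := fun h =>
    ⟨h.tauI_eq_tauO hcomplete hatomic,
      (h.tauI_eq_tauO hcomplete hatomic).symm.trans (h.tauI_eq_tauPhi hcomplete hatomic),
      h.orderConvergenceIsTopological hcomplete hatomic⟩
  tfae_have 4 → 1 := fun h =>
    LatticeEffectAlgebra.almostOrthogonal_of_tauI_eq_tauPhi (h.1.trans h.2.1)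
  tfae_finish
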